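/- For a group $G$ write $[x,y]=x^{-1}y^{-1}xy$ and $x^y=y^{-1}xy$. The transfinite lower central series of $G$ is defined by $\gamma_1(G)=G$, $\gamma_{\lambda+1}(G)=[\gamma_\lambda(G),G]$ for ordinals $\lambda\ge 1$, and $\gamma_\lambda(G)=\bigcap_{1\le\beta<\lambda}\gamma_\beta(G)$ for limit ordinals $\lambda$. The length of the lower central series of $G$ is the supremum of all ordinals $\lambda\ge 1$ with $\gamma_\lambda(G)\ne\gamma_{\lambda+1}(G)$ (the largest such $\lambda$ if there is one). A group $G$ is residually nilpotent if for every $1\ne g\in G$ there are a nilpotent group $N$ and a homomorphism $\varphi:G\to N$ with $\varphi(g)\ne 1$. Let $\omega$ denote the first infinite ordinal. **Theorem.** Let $G$ be a group with a normal subgroup $F$ that is free of finite rank $n\ge 2$, and let $a\in G$ be an element whose image generates $G/F$, where $G/F$ is infinite cyclic. Let $A=F/\gamma_2(F)$, written additively, and let $\alpha:A\to A$ be the $\mathbb Z$-linear map induced by conjugation by $a$, that is, $\alpha(x\gamma_2(F))=x^a\gamma_2(F)$ for $x\in F$. 1. If $(\alpha-\mathrm{id})^n=0$, then $G$ is residually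 nilpotent, and $\gamma_\omega(G)=1$. 2. If $(\alpha-\mathrm{id})^mA\subseteq MA$ for some $m,M\in\mathbb N$ with $M\ge 2$, then the length of the lower central series of $G$ is at most $\omega^2$, and $\gamma_{\omega^2}(G)=1$. -/

import Mathlib

open Ordinal

universe u

section TransfiniteLowerCentralSeries

/-- The transfinite lower central series `γ_α(G)`, indexed so that `γ_1(G) = G`,
`γ_{α+1}(G) = [γ_α(G), G]` for `α ≥ 1`, and `γ_α(G) = ⋂_{β < α} γ_β(G)` for limit `α`.
The index `0` is not used in the mathematics; the value there is `G`. -/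
noncomputable def transLCS (G : Type u) [Group G] (α : Ordinal.{u}) : Subgroup G :=
  open Classical in
  Ordinal.limitRecOn (motive := fun _ => Subgroup G) α
    ⊤
    (fun β S => if β = 0 then ⊤ else ⁅S, (⊤ : Subgroup G)⁆)
    (fun α _ S => ⨅ (β : Ordinal.{u}) (h : β < α), S β h)

theorem transLCS_zero (G : Type u) [Group G] : transLCS G 0 = ⊤ := by
  simp [transLCS]

theorem transLCS_one (G : Type u) [Group G] : transLCS G 1 = ⊤ := by
  have h : transLCS G (0 + 1) = ⊤ := by
    unfold transLCS
    rw [Ordinal.limitRecOn_add_one]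
    simp
  simpa using h

theorem transLCS_add_one (G : Type u) [Group G] {α : Ordinal.{u}} (hα : 1 ≤ α) :
    transLCS G (α + 1) = ⁅transLCS G α, (⊤ : Subgroup G)⁆ := by
  have h0 : α ≠ 0 := Order.one_le_iff_ne_zero.mp hα
  simp [transLCS, h0]

theorem transLCS_limit (G : Type u) [Group G] {α : Ordinal.{u}} (hα : Order.IsSuccLimit α) :
    transLCS G α = ⨅ (β : Ordinal.{u}) (_ : β < α), transLCS G β := by
  unfold transLCS
  rw [Ordinal.limitRecOn_limit (h := hα)]

theorem transLCS_normal (G : Type u) [Group G] (α : Ordinal.{u}) : (transLCS G α).Normal := by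
  induction α using Ordinal.limitRecOn with
  | zero => rw [transLCS_zero]; infer_instance
  | add_one α ih =>
    rcases eq_or_ne α 0 with rfl | h
    · rw [zero_add, transLCS_one]; infer_instance
    · rw [transLCS_add_one G (Order.one_le_iff_ne_zero.mpr h)]; infer_instance
  | limit α hα ih =>
    rw [transLCS_limit G hα]
    exact Subgroup.normal_iInf_normal fun β => Subgroup.normal_iInf_normal fun h => ih β h

theorem transLCS_antitone (G : Type u) [Group G] : Antitone (transLCS G) := by
  intro α β hab
  induction β using Ordinal.limitRecOn with
  | zero => rw [le_antisymm hab (zero_le (a := α))]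
  | add_one β ih =>
    rcases hab.eq_or_lt with h | h
    · rw [h]
    · have h1 : α ≤ β := Order.lt_succ_iff.mp (by simpa using h)
      refine le_trans ?_ (ih h1)
      rcases eq_or_ne β 0 with rfl | hb
      · rw [transLCS_zero]; exact le_top
      · rw [transLCS_add_one G (Order.one_le_iff_ne_zero.mpr hb)]
        have := transLCS_normal G β
        exact Subgroup.commutator_le_left _ _
  | limit β hb ih =>
    rcases hab.eq_or_lt with h | h
    · rw [h]
    · rw [transLCS_limit G hb]
      exact iInf₂_le α h

/-- The length of the (transfinite) lower central series of `G`: the supremum of the ordinals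
`α ≥ 1` with `γ_α(G) ≠ γ_{α+1}(G)`, that is, the largest such ordinal when there is one. -/
noncomputable def lcsLength (G : Type u) [Group G] : Ordinal.{u} :=
  sSup {α : Ordinal.{u} | 1 ≤ α ∧ transLCS G α ≠ transLCS G (α + 1)}

/-- The supremum defining `lcsLength` is a genuine one: the set is bounded. -/
theorem lcsLength_bddAbove (G : Type u) [Group G] :
    BddAbove {α : Ordinal.{u} | 1 ≤ α ∧ transLCS G α ≠ transLCS G (α + 1)} := by
  set S := {α : Ordinal.{u} | 1 ≤ α ∧ transLCS G α ≠ transLCS G (α + 1)}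
  have hinj : Function.Injective (fun α : S => transLCS G α.1) := by
    have key : ∀ α β : S, transLCS G α.1 = transLCS G β.1 → ¬ α.1 < β.1 := by
      intro α β h hlt
      apply α.2.2
      apply le_antisymm
      · rw [h]; exact transLCS_antitone G (Order.add_one_le_of_lt hlt)
      · exact transLCS_antitone G (by simp)
    intro α β h
    exact Subtype.ext (le_antisymm (not_lt.mp (key β α h.symm)) (not_lt.mp (key α β h)))
  have : Small.{u} S := small_of_injective hinj
  exact Ordinal.bddAbove_of_small

end TransfiniteLowerCentralSeries

/-- `G` is residually nilpotent: every nontrivial element survives in some nilpotent image. -/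
def IsResiduallyNilpotent (G : Type u) [Group G] : Prop :=
  ∀ g : G, g ≠ 1 → ∃ (N : Type u) (_ : Group N) (_ : Group.IsNilpotent N) (φ : G →* N), φ g ≠ 1

/-- The `ℤ`-linear map induced on the (additively written) abelianization `F / [F, F]` of a normal
subgroup `F` by conjugation `x ↦ x ^ a = a⁻¹ * x * a`. -/
noncomputable def conjOnAb {G : Type u} [Group G] (F : Subgroup G) [F.Normal] (a : G) :
    Module.End ℤ (Additive (Abelianization F)) :=
  (MonoidHom.toAdditive
    (Abelianization.map (MulAut.conjNormal (H := F) a⁻¹).toMonoidHom)).toIntLinearMap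

theorem conjOnAb_of {G : Type u} [Group G] (F : Subgroup G) [hF : F.Normal] (a : G) (x : F) :
    conjOnAb F a (Additive.ofMul (Abelianization.of x)) =
      Additive.ofMul (Abelianization.of
        (⟨a⁻¹ * x * a, by simpa using hF.conj_mem x x.2 a⁻¹⟩ : F)) := by
  have h : MulAut.conjNormal (H := F) a⁻¹ x =
      ⟨a⁻¹ * x * a, by simpa using hF.conj_mem x x.2 a⁻¹⟩ := by
    apply Subtype.ext
    simp
  rw [← h]
  rfl

/-!
Let `I` be the augmentation ideal of `ℤ[F]`, and let `D k = {x ∈ F | x - 1 ∈ I ^ k}` be the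
dimension subgroups of the free group `F`. They serve as a substitute for the lower central series
of `F`. Conjugation by `a` is an automorphism `σ` of `F`, and for `x ∈ D k` one has
`x⁻¹ xᵃ - 1 ≡ (σ - 1) (x - 1)` modulo `I ^ (k + 1)`, while `[D k, F] ⊆ D (k + 1)`. So on the section
`D k / D (k + 1)`, which embeds into `I ^ k / I ^ (k + 1)`, commutation with `G` amounts to applying
`σ - 1` (`commutator_le_map_congruenceSubgroup`).

Three facts about the quotients `I ^ k / I ^ (k + 1)` give the result.

* Nilpotency: `F / γ₂(F)` maps onto `I / I ^ 2`, so the hypothesis on `α` says that `σ - 1` is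
  nilpotent on `I / I ^ 2` modulo `M`, where `M = 0` covers the unipotent case. By the Leibniz rule
  `(σ - 1)(uv) = (σ - 1)u · v + u · (σ - 1)v + (σ - 1)u · (σ - 1)v`, it is then nilpotent modulo `M`
  on every `I ^ k / I ^ (k + 1)` (`exists_twist_pow_mem`).
* Separation: for `M ≥ 2` an element of `I ^ k / I ^ (k + 1)` divisible by all powers of `M`
  vanishes (`mem_augIdeal_pow_of_forall_pow_smul`). Fox derivatives map `I ^ (k + 1)` to `I ^ k` and
  detect it there, which reduces the claim to `ℤ[F] / I = ℤ`.
* Magnus: `⋂ D k = 1` (`eq_one_of_forall_sub_one_mem_augIdeal_pow`). The free group acts faithfully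
  on series in noncommuting variables `Xᵢ` with `Xᵢ² = 0`, the generator `xᵢ` acting as
  multiplication by `1 + Xᵢ`: following the component of top degree is a game of ping-pong. An
  element of `I ^ k` acts with image in the series of degree at least `k`.

If `α - 1` is nilpotent, finitely many steps of the lower central series of `G` lead from `D k` into
`D (k + 1)`, so its finite terms intersect trivially. In the second case `ω` steps do, by
separation, whence `γ_(2 + ω k)(G) ⊆ D (k + 1)` and `γ_(ω ^ 2)(G) = 1`.
-/

open scoped MonoidAlgebra

/-! ### The augmentation ideal of an integral group ring -/

section AugmentationIdeal

variable {H : Type*} [Group H]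

/-- The augmentation `ℤ[H] → ℤ`, sending every group element to `1`. -/
noncomputable def augmentation (H : Type*) [Group H] : ℤ[H] →ₐ[ℤ] ℤ :=
  MonoidAlgebra.lift ℤ ℤ H 1

/-- The augmentation ideal of `ℤ[H]`, as a `ℤ`-submodule, so that its powers are available
although `ℤ[H]` is not commutative. -/
noncomputable def augIdeal (H : Type*) [Group H] : Submodule ℤ ℤ[H] :=
  LinearMap.ker (augmentation H).toLinearMap

theorem mem_augIdeal {u : ℤ[H]} : u ∈ augIdeal H ↔ augmentation H u = 0 := Iff.rfl

theorem augmentation_of (x : H) : augmentation H (MonoidAlgebra.of ℤ H x) = 1 := by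
  rw [augmentation, MonoidAlgebra.lift_of]; rfl

theorem of_sub_one_mem_augIdeal (x : H) : MonoidAlgebra.of ℤ H x - 1 ∈ augIdeal H := by
  rw [mem_augIdeal, map_sub, augmentation_of, map_one]
  exact sub_self _

theorem sub_augmentation_mem_span (u : ℤ[H]) :
    u - algebraMap ℤ _ (augmentation H u) ∈
      Submodule.span ℤ (Set.range fun x : H => MonoidAlgebra.of ℤ H x - 1) := by
  induction u using MonoidAlgebra.induction_on with
  | of x =>
    rw [augmentation_of, map_one]
    exact Submodule.subset_span ⟨x, rfl⟩
  | add u v hu hv =>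
    rw [map_add, map_add, add_sub_add_comm]
    exact add_mem hu hv
  | smul r u hu =>
    have h : algebraMap ℤ ℤ[H] (augmentation H (r • u)) =
        r • algebraMap ℤ ℤ[H] (augmentation H u) := by
      rw [map_smul, Algebra.algebraMap_eq_smul_one, Algebra.algebraMap_eq_smul_one, smul_assoc]
    rw [h, ← smul_sub]
    exact Submodule.smul_mem _ _ hu

theorem augIdeal_eq_span :
    augIdeal H = Submodule.span ℤ (Set.range fun x : H => MonoidAlgebra.of ℤ H x - 1) := by
  refine le_antisymm (fun u hu => ?_) (Submodule.span_le.2 ?_)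
  · have h := sub_augmentation_mem_span u
    simpa [mem_augIdeal.1 hu] using h
  · rintro _ ⟨x, rfl⟩
    exact of_sub_one_mem_augIdeal x

theorem mul_mem_augIdeal_left (u : ℤ[H]) {v : ℤ[H]} (hv : v ∈ augIdeal H) : u * v ∈ augIdeal H := by
  rw [mem_augIdeal] at *
  rw [map_mul, hv, mul_zero]

theorem mul_mem_augIdeal_right {u : ℤ[H]} (hu : u ∈ augIdeal H) (v : ℤ[H]) :
    u * v ∈ augIdeal H := by
  rw [mem_augIdeal] at *
  rw [map_mul, hu, zero_mul]

theorem mul_mem_augIdeal_pow_left {k : ℕ} (hk : 1 ≤ k) (u : ℤ[H]) {v : ℤ[H]}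
    (hv : v ∈ augIdeal H ^ k) : u * v ∈ augIdeal H ^ k := by
  obtain ⟨k, rfl⟩ := Nat.exists_eq_add_of_le' hk
  rw [pow_succ'] at *
  induction hv using Submodule.mul_induction_on' with
  | mem_mul_mem a ha b hb =>
    rw [← mul_assoc]
    exact Submodule.mul_mem_mul (mul_mem_augIdeal_left u ha) hb
  | add a _ b _ ha hb => rw [mul_add]; exact add_mem ha hb

theorem mul_mem_augIdeal_pow_right {k : ℕ} (hk : 1 ≤ k) {u : ℤ[H]} (hu : u ∈ augIdeal H ^ k)
    (v : ℤ[H]) : u * v ∈ augIdeal H ^ k := by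
  obtain ⟨k, rfl⟩ := Nat.exists_eq_add_of_le' hk
  rw [pow_succ] at *
  induction hu using Submodule.mul_induction_on' with
  | mem_mul_mem a ha b hb =>
    rw [mul_assoc]
    exact Submodule.mul_mem_mul ha (mul_mem_augIdeal_right hb v)
  | add a _ b _ ha hb => rw [add_mul]; exact add_mem ha hb

theorem augIdeal_pow_succ_le {k : ℕ} (hk : 1 ≤ k) : augIdeal H ^ (k + 1) ≤ augIdeal H ^ k := by
  obtain ⟨k, rfl⟩ := Nat.exists_eq_add_of_le' hk
  rw [pow_succ _ (k + 1), pow_succ, mul_assoc]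
  refine mul_le_mul_right (Submodule.mul_le.2 fun u hu v _ => mul_mem_augIdeal_right hu v) _

theorem augIdeal_pow_le {k : ℕ} (hk : 1 ≤ k) : augIdeal H ^ k ≤ augIdeal H := by
  induction k, hk using Nat.le_induction with
  | base => rw [pow_one]
  | succ k hk ih => exact (augIdeal_pow_succ_le hk).trans ih

end AugmentationIdeal

/-! ### Fox calculus and separation -/

section FoxCalculus

variable {ι : Type*} [DecidableEq ι]

/-- The unit of `M₂(ℤ[F])` with rows `(xⱼ, 1)`, `(0, 1)` if `j = i` and `(xⱼ, 0)`, `(0, 1)`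
otherwise. -/
noncomputable def foxUnit (i j : ι) : (Matrix (Fin 2) (Fin 2) ℤ[FreeGroup ι])ˣ where
  val := !![MonoidAlgebra.of ℤ _ (FreeGroup.of j), if j = i then 1 else 0; 0, 1]
  inv := !![MonoidAlgebra.of ℤ _ (FreeGroup.of j)⁻¹,
    -(MonoidAlgebra.of ℤ _ (FreeGroup.of j)⁻¹ * if j = i then 1 else 0); 0, 1]
  val_inv := by
    simp only [Matrix.mul_fin_two, mul_neg, ← mul_assoc, ← map_mul, mul_inv_cancel, map_one,
      one_mul, mul_zero, zero_mul, add_zero, neg_zero, zero_add, mul_one,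
      neg_add_cancel, Matrix.one_fin_two]
  inv_val := by
    simp only [Matrix.mul_fin_two, ← map_mul, inv_mul_cancel, map_one,
      mul_zero, zero_mul, add_zero, zero_add, mul_one, add_neg_cancel, Matrix.one_fin_two]

/-- The representation of `ℤ[F]` on `M₂(ℤ[F])` whose off-diagonal entry is the Fox derivative. -/
noncomputable def foxRep (i : ι) : ℤ[FreeGroup ι] →ₐ[ℤ] Matrix (Fin 2) (Fin 2) ℤ[FreeGroup ι] :=
  MonoidAlgebra.lift ℤ _ _ ((Units.coeHom _).comp (FreeGroup.lift (foxUnit i)))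

theorem foxRep_of_of (i j : ι) : foxRep i (MonoidAlgebra.of ℤ _ (FreeGroup.of j)) =
    !![MonoidAlgebra.of ℤ _ (FreeGroup.of j), if j = i then 1 else 0; 0, 1] := by
  rw [foxRep, MonoidAlgebra.lift_of]
  simp [foxUnit]

theorem foxRep_of_of_inv (i j : ι) : foxRep i (MonoidAlgebra.of ℤ _ (FreeGroup.of j)⁻¹) =
    !![MonoidAlgebra.of ℤ _ (FreeGroup.of j)⁻¹,
    -(MonoidAlgebra.of ℤ _ (FreeGroup.of j)⁻¹ * if j = i then 1 else 0); 0, 1] := by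
  rw [foxRep, MonoidAlgebra.lift_of]
  simp [foxUnit]

/-- The Fox derivative `∂ᵢ : ℤ[F] → ℤ[F]` of the group ring of a free group: the linear map with
`∂ᵢ xⱼ = δᵢⱼ` and `∂ᵢ (u v) = u ∂ᵢ v + ε(v) ∂ᵢ u`. -/
noncomputable def foxDeriv (i : ι) : ℤ[FreeGroup ι] →ₗ[ℤ] ℤ[FreeGroup ι] :=
  Matrix.entryLinearMap ℤ ℤ[FreeGroup ι] 0 1 ∘ₗ (foxRep i).toLinearMap

theorem foxRep_eq (i : ι) (u : ℤ[FreeGroup ι]) :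
    foxRep i u = !![u, foxDeriv i u; 0, algebraMap ℤ _ (augmentation _ u)] := by
  suffices h : foxRep i u 0 0 = u ∧ foxRep i u 1 0 = 0 ∧
      foxRep i u 1 1 = algebraMap ℤ _ (augmentation _ u) by
    ext a b
    fin_cases a <;> fin_cases b <;> simp [h, foxDeriv]
  induction u using MonoidAlgebra.induction_on with
  | of x =>
    induction x using FreeGroup.induction_on with
    | C1 =>
      rw [map_one, map_one, map_one]; simp
    | of j => rw [foxRep_of_of, augmentation_of]; simp
    | inv_of j _ => rw [foxRep_of_of_inv, augmentation_of]; simp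
    | mul x y hx hy =>
      rw [augmentation_of] at *
      rw [map_mul, map_mul]
      simp only [Matrix.mul_apply, Fin.sum_univ_two, hx, hy]
      simp
  | add u v hu hv => simp [hu, hv]
  | smul r u hu =>
    rw [map_smul, map_smul]
    simp only [Matrix.smul_apply, hu]
    simp [Algebra.smul_def]

theorem foxDeriv_mul (i : ι) (u v : ℤ[FreeGroup ι]) :
    foxDeriv i (u * v) = u * foxDeriv i v + foxDeriv i u * algebraMap ℤ _ (augmentation _ v) := by
  have h := congrFun (congrFun (map_mul (foxRep i) u v) 0) 1
  simpa only [foxRep_eq, Matrix.mul_fin_two, Matrix.of_apply, Matrix.cons_val_zero,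
    Matrix.cons_val_one] using h

theorem mul_sub_mul_eq_of_commute {A : Type*} [Ring A] {u v a b : A} (hu : b * u = u * b)
    (ha : b * a = a * b) : u * v - a * b = u * (v - b) + b * (u - a) := by
  rw [_root_.mul_sub, _root_.mul_sub, hu, ha]
  abel

/-- The fundamental formula of Fox calculus. -/
theorem sub_augmentation_eq_sum_foxDeriv [Fintype ι] (u : ℤ[FreeGroup ι]) :
    u - algebraMap ℤ _ (augmentation _ u) =
      ∑ i, foxDeriv i u * (MonoidAlgebra.of ℤ _ (FreeGroup.of i) - 1) := by
  have hmul (u v : ℤ[FreeGroup ι])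
      (hu : u - algebraMap ℤ _ (augmentation _ u) =
        ∑ i, foxDeriv i u * (MonoidAlgebra.of ℤ _ (FreeGroup.of i) - 1))
      (hv : v - algebraMap ℤ _ (augmentation _ v) =
        ∑ i, foxDeriv i v * (MonoidAlgebra.of ℤ _ (FreeGroup.of i) - 1)) :
      u * v - algebraMap ℤ _ (augmentation _ (u * v)) =
        ∑ i, foxDeriv i (u * v) * (MonoidAlgebra.of ℤ _ (FreeGroup.of i) - 1) := by
    have h : u * v - algebraMap ℤ _ (augmentation _ (u * v)) =
        u * (v - algebraMap ℤ _ (augmentation _ v)) +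
          algebraMap ℤ _ (augmentation _ v) * (u - algebraMap ℤ _ (augmentation _ u)) := by
      rw [map_mul, map_mul]
      exact mul_sub_mul_eq_of_commute (Algebra.commutes _ u) (Algebra.commutes _ _)
    rw [h, hu, hv, Finset.mul_sum, Finset.mul_sum, ← Finset.sum_add_distrib]
    refine Finset.sum_congr rfl fun i _ => ?_
    rw [foxDeriv_mul, add_mul, ← Algebra.commutes, mul_assoc, mul_assoc]
  induction u using MonoidAlgebra.induction_on with
  | of x =>
    induction x using FreeGroup.induction_on with
    | C1 =>
      have h (i : ι) : foxDeriv i 1 = 0 := by simp [foxDeriv]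
      rw [map_one, map_one]; simp [h]
    | of j =>
      have h (i : ι) : foxDeriv i (MonoidAlgebra.of ℤ _ (FreeGroup.of j)) =
          if j = i then 1 else 0 := by simp [foxDeriv, -MonoidAlgebra.of_apply, foxRep_of_of]
      rw [augmentation_of]; simp [h, -MonoidAlgebra.of_apply]
    | inv_of j _ =>
      have h (i : ι) : foxDeriv i (MonoidAlgebra.of ℤ _ (FreeGroup.of j)⁻¹) =
          if j = i then -MonoidAlgebra.of ℤ _ (FreeGroup.of j)⁻¹ else 0 := by
        split_ifs <;> simp [foxDeriv, -MonoidAlgebra.of_apply, foxRep_of_of_inv, *]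
      rw [augmentation_of]
      simp only [h, ite_mul, zero_mul, Finset.sum_ite_eq, Finset.mem_univ, if_true, map_one]
      rw [_root_.mul_sub, neg_mul, ← map_mul, inv_mul_cancel, map_one, mul_one]
      abel
    | mul x y hx hy =>
      rw [map_mul]
      exact hmul _ _ hx hy
  | add u v hu hv =>
    simp only [map_add, add_mul, Finset.sum_add_distrib, ← hu, ← hv]
    abel
  | smul r u hu =>
    simp only [map_smul, smul_mul_assoc, ← Finset.smul_sum, ← hu, smul_sub]
    simp [Algebra.smul_def]

theorem foxDeriv_mem_augIdeal_pow (i : ι) {k : ℕ} (hk : 1 ≤ k) {u : ℤ[FreeGroup ι]}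
    (hu : u ∈ augIdeal (FreeGroup ι) ^ (k + 1)) : foxDeriv i u ∈ augIdeal (FreeGroup ι) ^ k := by
  rw [pow_succ] at hu
  induction hu using Submodule.mul_induction_on' with
  | mem_mul_mem a ha b hb =>
    rw [foxDeriv_mul, mem_augIdeal.1 hb, map_zero, mul_zero, add_zero]
    exact mul_mem_augIdeal_pow_right hk ha _
  | add a _ b _ ha hb => rw [map_add]; exact add_mem ha hb

theorem mem_augIdeal_pow_of_foxDeriv [Fintype ι] {k : ℕ} {u : ℤ[FreeGroup ι]}
    (hu : u ∈ augIdeal (FreeGroup ι))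
    (h : ∀ i, foxDeriv i u ∈ augIdeal (FreeGroup ι) ^ k) :
    u ∈ augIdeal (FreeGroup ι) ^ (k + 1) := by
  have hsum := sub_augmentation_eq_sum_foxDeriv u
  rw [mem_augIdeal.1 hu, map_zero] at hsum
  rw [(sub_zero u).symm.trans hsum, pow_succ]
  exact sum_mem fun i _ => Submodule.mul_mem_mul (h i) (of_sub_one_mem_augIdeal _)

theorem int_eq_zero_of_forall_pow_dvd {M : ℕ} (hM : 2 ≤ M) {z : ℤ} (h : ∀ j : ℕ, (M : ℤ) ^ j ∣ z) :
    z = 0 := by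
  refine Int.eq_zero_of_abs_lt_dvd (h z.natAbs) ?_
  have h2 : z.natAbs < M ^ z.natAbs := Nat.lt_pow_self hM
  rw [Int.abs_eq_natAbs]
  exact_mod_cast h2

/-- The quotients `I ^ k / I ^ (k + 1)` for the augmentation ideal `I` of a free group of finite
rank are separated in the `M`-adic topology. The Fox derivatives reduce this to `ℤ[F] / I = ℤ`. For
`k = 0` the witness `v` is unrestricted: as a `ℤ`-submodule, `I ^ 0` is `ℤ`, not `ℤ[F]`. -/
theorem mem_augIdeal_pow_of_forall_pow_smul [Fintype ι] {M : ℕ} (hM : 2 ≤ M) (k : ℕ)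
    (u : ℤ[FreeGroup ι])
    (h : ∀ j : ℕ, ∃ v : ℤ[FreeGroup ι], (1 ≤ k → v ∈ augIdeal (FreeGroup ι) ^ k) ∧
      u - M ^ j • v ∈ augIdeal (FreeGroup ι) ^ (k + 1)) :
    u ∈ augIdeal (FreeGroup ι) ^ (k + 1) := by
  induction k generalizing u with
  | zero =>
    rw [zero_add, pow_one, mem_augIdeal]
    refine int_eq_zero_of_forall_pow_dvd hM fun j => ?_
    obtain ⟨v, -, hv⟩ := h j
    rw [zero_add, pow_one, mem_augIdeal, map_sub, map_nsmul] at hv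
    exact ⟨augmentation _ v, by simpa [sub_eq_zero] using hv⟩
  | succ k ih =>
    refine mem_augIdeal_pow_of_foxDeriv ?_ fun i => ih _ fun j => ?_
    · obtain ⟨v, hv, huv⟩ := h 0
      have h1 := add_mem (augIdeal_pow_succ_le (by omega) huv) (hv (by omega))
      rw [pow_zero, one_smul, sub_add_cancel] at h1
      exact augIdeal_pow_le (by omega) h1
    · obtain ⟨v, hv, huv⟩ := h j
      refine ⟨foxDeriv i v, fun hk => foxDeriv_mem_augIdeal_pow i hk (hv (by omega)), ?_⟩
      rw [← map_nsmul, ← map_sub]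
      exact foxDeriv_mem_augIdeal_pow i (by omega) huv

end FoxCalculus

/-! ### Faithfulness of the Magnus representation -/

section MagnusRepresentation

variable {ι : Type*}

/-- The series with a nonzero homogeneous component of top degree in which only words starting
with the letter `i` occur. -/
def topSeries (i : ι) : Set (List ι → ℤ) :=
  {f | ∃ d, (∀ w, d < w.length → f w = 0) ∧
    (∀ w, w.length = d → f w ≠ 0 → w.head? = some i) ∧ ∃ w, w.length = d ∧ f w ≠ 0}

theorem topSeries_disjoint {i j : ι} (hij : i ≠ j) : Disjoint (topSeries i) (topSeries j) := by
  rw [Set.disjoint_left]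
  rintro f ⟨d, h1, h2, w, hw, hfw⟩ ⟨e, h3, h4, w', hw', hfw'⟩
  have hde : d = e := by
    refine le_antisymm ?_ ?_
    · by_contra! h; exact hfw (h3 w (hw ▸ h))
    · by_contra! h; exact hfw' (h1 w' (hw' ▸ h))
  subst hde
  exact hij (Option.some.inj ((h2 w hw hfw).symm.trans (h4 w hw hfw)))

variable [DecidableEq ι]

/-- Left multiplication by the letter `i` on formal series in words over `ι`, in the ring of
noncommutative series in which all squares of letters vanish. A series is the function giving its
coefficients. -/
def letterMul (i : ι) : Module.End ℤ (List ι → ℤ) where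
  toFun f w := match w with
    | [] => 0
    | j :: t => if j = i ∧ t.head? ≠ some i then f t else 0
  map_add' f g := by
    funext w
    rcases w with _ | ⟨j, t⟩
    · rfl
    · dsimp only [Pi.add_apply]; split_ifs <;> simp
  map_smul' r f := by
    funext w
    rcases w with _ | ⟨j, t⟩
    · simp
    · simp

theorem letterMul_nil (i : ι) (f : List ι → ℤ) : letterMul i f [] = 0 := rfl

theorem letterMul_cons (i j : ι) (t : List ι) (f : List ι → ℤ) :
    letterMul i f (j :: t) = if j = i ∧ t.head? ≠ some i then f t else 0 := rfl

theorem letterMul_mul_self (i : ι) : letterMul i * letterMul i = 0 := by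
  ext f w
  rcases w with _ | ⟨j, _ | ⟨k, t⟩⟩
  · rfl
  · simp [letterMul_cons, letterMul_nil]
  · simp only [Module.End.mul_apply, letterMul_cons]
    by_cases h : k = i <;> simp [h]

/-- The one-parameter group `e ↦ (1 + Xᵢ) ^ e = 1 + e Xᵢ`. -/
def letterHom (i : ι) : Multiplicative ℤ →* (Module.End ℤ (List ι → ℤ))ˣ :=
  MonoidHom.toHomUnits
    { toFun := fun e => 1 + e.toAdd • letterMul i
      map_one' := by simp
      map_mul' := fun d e => by
        rw [toAdd_mul, add_mul, one_mul, _root_.mul_add, mul_one, smul_mul_smul_comm,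
          letterMul_mul_self, smul_zero, add_zero, add_smul]
        abel }

theorem letterHom_apply (i : ι) (e : Multiplicative ℤ) (f : List ι → ℤ) :
    letterHom i e • f = f + e.toAdd • letterMul i f := rfl

theorem topSeries_nonempty (i : ι) : (topSeries i).Nonempty := by
  refine ⟨Pi.single [i] 1, 1, fun w hw => ?_, fun w _ h => ?_, [i], rfl, by simp⟩
  · rw [Pi.single_apply, if_neg]
    rintro rfl
    simp at hw
  · rw [Pi.single_apply] at h
    have : w = [i] := by by_contra h'; simp [h'] at h
    simp [this]

/-- The ping-pong move: multiplying by `1 + e Xᵢ` with `e ≠ 0` replaces the top component `p` by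
`e Xᵢ p`. -/
theorem letterHom_smul_mem_topSeries {i j : ι} (hij : i ≠ j) {e : Multiplicative ℤ} (he : e ≠ 1)
    {f : List ι → ℤ} (hf : f ∈ topSeries j) : letterHom i e • f ∈ topSeries i := by
  obtain ⟨d, h1, h2, w, hw, hfw⟩ := hf
  have he' : e.toAdd ≠ 0 := fun h => he h
  refine ⟨d + 1, fun w hw => ?_, fun w hw h => ?_, i :: w, by simp [hw], ?_⟩
  · rw [letterHom_apply, Pi.add_apply, Pi.smul_apply, h1 w (by omega)]
    rcases w with _ | ⟨k, t⟩
    · simp at hw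
    · rw [letterMul_cons, h1 t (by simpa using hw)]
      simp
  · rw [letterHom_apply, Pi.add_apply, Pi.smul_apply, h1 w (by omega)] at h
    rcases w with _ | ⟨k, t⟩
    · simp at hw
    · rw [letterMul_cons] at h
      by_cases hk : k = i
      · simp [hk]
      · simp [hk] at h
  · rw [letterHom_apply, Pi.add_apply, Pi.smul_apply, h1 (i :: w) (by simp [hw]), letterMul_cons,
      h2 w hw hfw, if_pos ⟨rfl, fun h => hij (Option.some.inj h).symm⟩]
    simp [he', hfw]

/-- The representation of the free group on series sending `xᵢ` to multiplication by `1 + Xᵢ`. -/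
noncomputable def magnusRep : FreeGroup ι →* (Module.End ℤ (List ι → ℤ))ˣ :=
  (Monoid.CoprodI.lift fun i =>
    (letterHom i).comp (FreeGroup.mulEquivIntOfUnique (α := Unit)).toMonoidHom).comp
    (freeGroupEquivCoprodI (ι := ι)).toMonoidHom

theorem magnusRep_of (i : ι) :
    magnusRep (FreeGroup.of i) = letterHom i (Multiplicative.ofAdd 1) := by
  have h : freeGroupEquivCoprodI (FreeGroup.of i) =
      Monoid.CoprodI.of (M := fun _ : ι => FreeGroup Unit) (i := i) (FreeGroup.of ()) := by
    simp [freeGroupEquivCoprodI]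
  rw [magnusRep, MonoidHom.comp_apply, MulEquiv.coe_toMonoidHom, h, Monoid.CoprodI.lift_of]
  rfl

theorem magnusRep_injective [Nontrivial ι] : Function.Injective (magnusRep (ι := ι)) := by
  rw [magnusRep, MonoidHom.coe_comp]
  refine Function.Injective.comp ?_ (freeGroupEquivCoprodI (ι := ι)).injective
  refine Monoid.CoprodI.lift_injective_of_ping_pong _ (Or.inr ?_) topSeries topSeries_nonempty
    (fun i j hij => topSeries_disjoint hij) ?_
  · obtain ⟨i⟩ : Nonempty ι := inferInstance
    exact ⟨i, (Cardinal.natCast_le_aleph0 (n := 3)).trans (Cardinal.aleph0_le_mk _)⟩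
  · rintro i j hij h hh _ ⟨f, hf, rfl⟩
    exact letterHom_smul_mem_topSeries hij (by simpa using hh) hf

/-- Group elements act trivially on the components of lowest degree. -/
theorem magnusRep_apply_of_length_le (x : FreeGroup ι) (k : ℕ) (f : List ι → ℤ)
    (hf : ∀ w, w.length < k → f w = 0) (w : List ι) (hw : w.length ≤ k) :
    (magnusRep x • f) w = f w := by
  have hmul (i : ι) (f : List ι → ℤ) (hf : ∀ w, w.length < k → f w = 0) (w : List ι)
      (hw : w.length ≤ k) : letterMul i f w = 0 := by
    rcases w with _ | ⟨j, t⟩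
    · rfl
    · rw [letterMul_cons, hf t (by simpa using hw), ite_self]
  induction x using FreeGroup.induction_on generalizing f w with
  | C1 => rw [map_one, one_smul]
  | of i =>
    rw [magnusRep_of, letterHom_apply, Pi.add_apply, Pi.smul_apply, hmul i f hf w hw]
    simp
  | inv_of i _ =>
    rw [map_inv, magnusRep_of, ← map_inv, letterHom_apply, Pi.add_apply, Pi.smul_apply,
      hmul i f hf w hw]
    simp
  | mul x y hx hy =>
    have h0 : ∀ w, w.length < k → (magnusRep y • f) w = 0 := fun w hw =>
      (hy f hf w hw.le).trans (hf w hw)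
    rw [map_mul, mul_smul, hx _ h0 w hw, hy f hf w hw]

/-- The linear extension of `magnusRep` to the group ring. -/
noncomputable def magnusAlgHom : ℤ[FreeGroup ι] →ₐ[ℤ] Module.End ℤ (List ι → ℤ) :=
  MonoidAlgebra.lift ℤ _ _ ((Units.coeHom _).comp magnusRep)

theorem magnusAlgHom_of (x : FreeGroup ι) (f : List ι → ℤ) :
    magnusAlgHom (MonoidAlgebra.of ℤ _ x) f = magnusRep x • f := by
  rw [magnusAlgHom, MonoidAlgebra.lift_of]
  rfl

theorem magnusAlgHom_apply_eq_zero {k : ℕ} {u : ℤ[FreeGroup ι]}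
    (hu : u ∈ augIdeal (FreeGroup ι) ^ k) (f : List ι → ℤ) (w : List ι) (hw : w.length < k) :
    magnusAlgHom u f w = 0 := by
  induction k generalizing u w with
  | zero => omega
  | succ k ih =>
    rw [pow_succ'] at hu
    induction hu using Submodule.mul_induction_on' with
    | mem_mul_mem a ha b hb =>
      rw [map_mul, Module.End.mul_apply]
      have h0 : ∀ w, w.length < k → magnusAlgHom b f w = 0 := fun w hw => ih hb w hw
      generalize magnusAlgHom b f = g at h0
      rw [augIdeal_eq_span] at ha
      induction ha using Submodule.span_induction with
      | mem a ha =>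
        obtain ⟨x, rfl⟩ := ha
        dsimp only
        rw [map_sub, map_one, LinearMap.sub_apply, Pi.sub_apply, magnusAlgHom_of,
          magnusRep_apply_of_length_le x k g h0 w (by omega), Module.End.one_apply]
        exact sub_self _
      | zero => simp
      | add a b _ _ ha hb => rw [map_add, LinearMap.add_apply, Pi.add_apply, ha, hb, add_zero]
      | smul r a _ ha => rw [map_smul, LinearMap.smul_apply, Pi.smul_apply, ha, smul_zero]
    | add a _ b _ ha hb => rw [map_add, LinearMap.add_apply, Pi.add_apply, ha, hb, add_zero]

/-- Magnus's theorem: the dimension subgroups of a free group intersect trivially. -/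
theorem eq_one_of_forall_sub_one_mem_augIdeal_pow [Nontrivial ι] (x : FreeGroup ι)
    (h : ∀ k, 1 ≤ k → MonoidAlgebra.of ℤ _ x - 1 ∈ augIdeal (FreeGroup ι) ^ k) : x = 1 := by
  refine magnusRep_injective ?_
  rw [map_one]
  refine Units.ext (LinearMap.ext fun f => funext fun w => ?_)
  have h1 := magnusAlgHom_apply_eq_zero (h (w.length + 1) (by omega)) f w (by omega)
  rw [map_sub, map_one, LinearMap.sub_apply, Pi.sub_apply, magnusAlgHom_of, sub_eq_zero] at h1
  exact h1

end MagnusRepresentation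

/-! ### The operator `σ - 1` on powers of the augmentation ideal -/

section Twist

variable {H : Type*} [Group H] (σ : H →* H)

/-- The operator `σ - 1` on `ℤ[H]` for an endomorphism `σ` of `H`. -/
noncomputable def twist : Module.End ℤ ℤ[H] :=
  (MonoidAlgebra.mapDomainAlgHom ℤ ℤ σ).toLinearMap - 1

theorem twist_apply (u : ℤ[H]) : twist σ u = MonoidAlgebra.mapDomainAlgHom ℤ ℤ σ u - u := rfl

theorem twist_of (x : H) :
    twist σ (MonoidAlgebra.of ℤ H x) = MonoidAlgebra.of ℤ H (σ x) - MonoidAlgebra.of ℤ H x := by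
  rw [twist_apply]; simp

theorem twist_one : twist σ 1 = 0 := by
  rw [twist_apply, map_one]
  exact sub_self _

/-- The Leibniz rule for `σ - 1`. -/
theorem twist_mul (u v : ℤ[H]) :
    twist σ (u * v) = twist σ u * v + u * twist σ v + twist σ u * twist σ v := by
  rw [twist_apply, twist_apply, twist_apply, map_mul]
  noncomm_ring

theorem mapDomainAlgHom_mem_augIdeal {u : ℤ[H]} (hu : u ∈ augIdeal H) :
    MonoidAlgebra.mapDomainAlgHom ℤ ℤ σ u ∈ augIdeal H := by
  rw [augIdeal_eq_span] at hu
  induction hu using Submodule.span_induction with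
  | mem u hu =>
    obtain ⟨x, rfl⟩ := hu
    have h : MonoidAlgebra.mapDomainAlgHom ℤ ℤ σ (MonoidAlgebra.of ℤ H x - 1) =
        MonoidAlgebra.of ℤ H (σ x) - 1 := by rw [map_sub, map_one]; simp
    exact h ▸ of_sub_one_mem_augIdeal _
  | zero => rw [map_zero]; exact zero_mem _
  | add u v _ _ hu hv => rw [map_add]; exact add_mem hu hv
  | smul r u _ hu => rw [map_smul]; exact Submodule.smul_mem _ _ hu

theorem mapDomainAlgHom_mem_augIdeal_pow {k : ℕ} {u : ℤ[H]} (hu : u ∈ augIdeal H ^ k) :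
    MonoidAlgebra.mapDomainAlgHom ℤ ℤ σ u ∈ augIdeal H ^ k := by
  have h := Submodule.mem_map_of_mem (f := (MonoidAlgebra.mapDomainAlgHom ℤ ℤ σ).toLinearMap) hu
  rw [Submodule.map_pow] at h
  have hle : (augIdeal H).map (MonoidAlgebra.mapDomainAlgHom ℤ ℤ σ).toLinearMap ≤ augIdeal H := by
    rintro _ ⟨v, hv, rfl⟩
    exact mapDomainAlgHom_mem_augIdeal σ hv
  exact pow_le_pow_left' hle k h

theorem twist_mem_augIdeal_pow {k : ℕ} {u : ℤ[H]} (hu : u ∈ augIdeal H ^ k) :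
    twist σ u ∈ augIdeal H ^ k :=
  sub_mem (mapDomainAlgHom_mem_augIdeal_pow σ hu) hu

theorem twist_pow_mem_augIdeal_pow (j : ℕ) {k : ℕ} {u : ℤ[H]} (hu : u ∈ augIdeal H ^ k) :
    (twist σ ^ j) u ∈ augIdeal H ^ k := by
  induction j with
  | zero => exact hu
  | succ j ih => rw [pow_succ', Module.End.mul_apply]; exact twist_mem_augIdeal_pow σ ih

/-- The submodule `M I ^ k + I ^ (k + 1)` of the group ring, with `I` its augmentation ideal. -/
noncomputable def augIdealMod (H : Type*) [Group H] (M k : ℕ) : Submodule ℤ ℤ[H] :=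
  (augIdeal H ^ k).map ((M : ℤ) • LinearMap.id) ⊔ augIdeal H ^ (k + 1)

theorem mem_augIdealMod {M k : ℕ} {u : ℤ[H]} : u ∈ augIdealMod H M k ↔
    ∃ v ∈ augIdeal H ^ k, ∃ w ∈ augIdeal H ^ (k + 1), (M : ℤ) • v + w = u := by
  simp [augIdealMod, Submodule.mem_sup]

theorem twist_mem_augIdealMod {M k : ℕ} {u : ℤ[H]} (hu : u ∈ augIdealMod H M k) :
    twist σ u ∈ augIdealMod H M k := by
  obtain ⟨v, hv, w, hw, rfl⟩ := mem_augIdealMod.1 hu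
  refine mem_augIdealMod.2 ⟨_, twist_mem_augIdeal_pow σ hv, _, twist_mem_augIdeal_pow σ hw, ?_⟩
  rw [map_add, map_smul]

theorem twist_pow_mem_augIdealMod (j : ℕ) {M k : ℕ} {u : ℤ[H]} (hu : u ∈ augIdealMod H M k) :
    (twist σ ^ j) u ∈ augIdealMod H M k := by
  induction j with
  | zero => exact hu
  | succ j ih => rw [pow_succ', Module.End.mul_apply]; exact twist_mem_augIdealMod σ ih

theorem mul_mem_augIdealMod_left {M k : ℕ} {u v : ℤ[H]} (hu : u ∈ augIdealMod H M k)
    (hv : v ∈ augIdeal H) : u * v ∈ augIdealMod H M (k + 1) := by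
  obtain ⟨v', hv', w, hw, rfl⟩ := mem_augIdealMod.1 hu
  refine mem_augIdealMod.2 ⟨v' * v, ?_, w * v, ?_, ?_⟩
  · rw [pow_succ]; exact Submodule.mul_mem_mul hv' hv
  · rw [pow_succ]; exact Submodule.mul_mem_mul hw hv
  · rw [add_mul, smul_mul_assoc]

theorem mul_mem_augIdealMod_right {M k : ℕ} {u v : ℤ[H]} (hu : u ∈ augIdeal H ^ k)
    (hv : v ∈ augIdealMod H M 1) : u * v ∈ augIdealMod H M (k + 1) := by
  obtain ⟨v', hv', w, hw, rfl⟩ := mem_augIdealMod.1 hv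
  refine mem_augIdealMod.2 ⟨u * v', ?_, u * w, ?_, ?_⟩
  · rw [pow_add]; exact Submodule.mul_mem_mul hu hv'
  · rw [add_assoc, pow_add]; exact Submodule.mul_mem_mul hu hw
  · rw [_root_.mul_add, mul_smul_comm]

/-- If `(σ - 1) ^ s` and `(σ - 1) ^ t` kill `u` and `v` modulo `M`, then `(σ - 1) ^ (s + t)` kills
`u * v`, by the Leibniz rule. -/
theorem twist_pow_mul_mem {M k : ℕ} (r : ℕ) {s t : ℕ} (hr : s + t ≤ r) {u v : ℤ[H]}
    (hu : u ∈ augIdeal H ^ k) (hv : v ∈ augIdeal H)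
    (hsu : (twist σ ^ s) u ∈ augIdealMod H M k) (htv : (twist σ ^ t) v ∈ augIdealMod H M 1) :
    (twist σ ^ r) (u * v) ∈ augIdealMod H M (k + 1) := by
  induction r generalizing s t u v with
  | zero =>
    obtain rfl : s = 0 := by omega
    exact mul_mem_augIdealMod_left hsu hv
  | succ r ih =>
    rcases s with _ | s
    · exact twist_pow_mem_augIdealMod σ _ (mul_mem_augIdealMod_left hsu hv)
    rcases t with _ | t
    · exact twist_pow_mem_augIdealMod σ _ (mul_mem_augIdealMod_right hu htv)
    have hv1 : twist σ v ∈ augIdeal H := by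
      rw [← pow_one (augIdeal H)] at hv ⊢
      exact twist_mem_augIdeal_pow σ hv
    have hu1 := twist_mem_augIdeal_pow σ hu
    have hsu1 : (twist σ ^ s) (twist σ u) ∈ augIdealMod H M k := by
      rwa [← Module.End.mul_apply, ← pow_succ]
    have htv1 : (twist σ ^ t) (twist σ v) ∈ augIdealMod H M 1 := by
      rwa [← Module.End.mul_apply, ← pow_succ]
    rw [pow_succ, Module.End.mul_apply, twist_mul, map_add, map_add]
    exact add_mem (add_mem (ih (by omega) hu1 hv hsu1 htv) (ih (by omega) hu hv1 hsu htv1))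
      (ih (by omega) hu1 hv1 hsu1 htv1)

/-- If `σ - 1` is nilpotent on `I / I ^ 2` modulo `M`, then it is nilpotent modulo `M` on every
`I ^ k / I ^ (k + 1)`. -/
theorem exists_twist_pow_mem {M m : ℕ}
    (h : ∀ u ∈ augIdeal H, (twist σ ^ m) u ∈ augIdealMod H M 1) {k : ℕ} (hk : 1 ≤ k) :
    ∃ N : ℕ, ∀ u ∈ augIdeal H ^ k, (twist σ ^ N) u ∈ augIdealMod H M k := by
  induction k, hk using Nat.le_induction with
  | base => exact ⟨m, fun u hu => h u (by rwa [pow_one] at hu)⟩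
  | succ k hk ih =>
    obtain ⟨N, hN⟩ := ih
    refine ⟨N + m, fun u hu => ?_⟩
    rw [pow_succ] at hu
    induction hu using Submodule.mul_induction_on' with
    | mem_mul_mem a ha b hb => exact twist_pow_mul_mem σ _ le_rfl ha hb (hN a ha) (h b hb)
    | add a _ b _ ha hb => rw [map_add]; exact add_mem ha hb

theorem twist_pow_mul_mem_augIdealMod {M N k : ℕ}
    (h : ∀ u ∈ augIdeal H ^ k, (twist σ ^ N) u ∈ augIdealMod H M k) (j : ℕ) {u : ℤ[H]}
    (hu : u ∈ augIdeal H ^ k) : (twist σ ^ (N * j)) u ∈ augIdealMod H (M ^ j) k := by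
  induction j generalizing u with
  | zero =>
    exact mem_augIdealMod.2 ⟨u, hu, 0, zero_mem _, by simp⟩
  | succ j ih =>
    obtain ⟨v, hv, w, hw, hvw⟩ := mem_augIdealMod.1 (h u hu)
    obtain ⟨v', hv', w', hw', hvw'⟩ := mem_augIdealMod.1 (ih hv)
    refine mem_augIdealMod.2 ⟨v', hv', (M : ℤ) • w' + (twist σ ^ (N * j)) w,
      add_mem (Submodule.smul_mem _ _ hw') (twist_pow_mem_augIdeal_pow σ _ hw), ?_⟩
    rw [Nat.mul_succ, pow_add (twist σ), Module.End.mul_apply, ← hvw, map_add, map_smul, ← hvw',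
      smul_add, ← add_assoc, smul_smul, pow_succ', Nat.cast_mul]

end Twist

/-! ### Commutators and congruence subgroups -/

section CongruenceSubgroup

variable {H : Type*} [Group H]

/-- The subgroup `{x | x - 1 ∈ U}` of `H`, for a submodule `U` of `ℤ[H]` that is stable under left
multiplication by the augmentation ideal. -/
def congruenceSubgroup (U : Submodule ℤ ℤ[H]) (hU : ∀ u ∈ augIdeal H, ∀ v ∈ U, u * v ∈ U) :
    Subgroup H where
  carrier := {x | MonoidAlgebra.of ℤ H x - 1 ∈ U}
  one_mem' := by
    have h : MonoidAlgebra.of ℤ H 1 - 1 = 0 := by rw [map_one]; exact sub_self _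
    rw [Set.mem_ofPred_eq, h]
    exact zero_mem U
  mul_mem' {x y} hx hy := by
    have h : MonoidAlgebra.of ℤ H (x * y) - 1 =
        (MonoidAlgebra.of ℤ H x - 1) * (MonoidAlgebra.of ℤ H y - 1) +
          (MonoidAlgebra.of ℤ H x - 1) + (MonoidAlgebra.of ℤ H y - 1) := by
      rw [map_mul]; noncomm_ring
    rw [Set.mem_ofPred_eq, h]
    exact add_mem (add_mem (hU _ (of_sub_one_mem_augIdeal x) _ hy) hx) hy
  inv_mem' {x} hx := by
    have h : MonoidAlgebra.of ℤ H x⁻¹ - 1 =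
        -((MonoidAlgebra.of ℤ H x⁻¹ - 1) * (MonoidAlgebra.of ℤ H x - 1)) -
          (MonoidAlgebra.of ℤ H x - 1) := by
      have h1 : MonoidAlgebra.of ℤ H x⁻¹ * MonoidAlgebra.of ℤ H x = 1 := by
        rw [← map_mul, inv_mul_cancel, map_one]
      rw [sub_mul, _root_.mul_sub, h1]; noncomm_ring
    rw [Set.mem_ofPred_eq, h]
    exact sub_mem (neg_mem (hU _ (of_sub_one_mem_augIdeal _) _ hx)) hx

theorem mem_congruenceSubgroup {U : Submodule ℤ ℤ[H]}
    {hU : ∀ u ∈ augIdeal H, ∀ v ∈ U, u * v ∈ U} {x : H} :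
    x ∈ congruenceSubgroup U hU ↔ MonoidAlgebra.of ℤ H x - 1 ∈ U := Iff.rfl

theorem of_mul_mem_of_augIdeal_mul_mem {U : Submodule ℤ ℤ[H]}
    (hU : ∀ u ∈ augIdeal H, ∀ v ∈ U, u * v ∈ U) (x : H) {v : ℤ[H]} (hv : v ∈ U) :
    MonoidAlgebra.of ℤ H x * v ∈ U := by
  have h : MonoidAlgebra.of ℤ H x * v = (MonoidAlgebra.of ℤ H x - 1) * v + v := by noncomm_ring
  exact h ▸ add_mem (hU _ (of_sub_one_mem_augIdeal x) _ hv) hv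

/-- Let `T` be a normal subgroup of `G`, where `G` is generated by the image of `θ : H → G` and an
element `a` acting on `H` as `σ`. If `T` lies in the congruence subgroup of `U`, and `U'` contains
`(σ - 1) U`, `U I` and `I U`, then `[T, G]` lies in the congruence subgroup of `U'`. -/
theorem commutator_le_map_congruenceSubgroup {G : Type*} [Group G] (θ : H →* G) (σ : H →* H)
    (a : G) (hσ : ∀ x, θ (σ x) = a⁻¹ * θ x * a)
    (hgen : ∀ S : Subgroup G, θ.range ≤ S → a ∈ S → S = ⊤)
    (T : Subgroup G) [T.Normal] {U U' : Submodule ℤ ℤ[H]}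
    (hU : ∀ u ∈ augIdeal H, ∀ v ∈ U, u * v ∈ U) (hU' : ∀ u ∈ augIdeal H, ∀ v ∈ U', u * v ∈ U')
    (hT : T ≤ (congruenceSubgroup U hU).map θ)
    (htwist : ∀ u ∈ U, twist σ u ∈ U')
    (hleft : ∀ u ∈ augIdeal H, ∀ v ∈ U, u * v ∈ U')
    (hright : ∀ u ∈ augIdeal H, ∀ v ∈ U, v * u ∈ U') :
    ⁅T, (⊤ : Subgroup G)⁆ ≤ (congruenceSubgroup U' hU').map θ := by
  -- Normality of `T` makes `S` a subgroup although `U'` need not be invariant under `G`.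
  let S : Subgroup G :=
    { carrier := {g | ∀ x ∈ T, x⁻¹ * (g⁻¹ * x * g) ∈ (congruenceSubgroup U' hU').map θ}
      one_mem' := fun x _ => by simp
      mul_mem' := fun {g h} hg hh x hx => by
        have hx' : g⁻¹ * x * g ∈ T := by simpa using ‹T.Normal›.conj_mem x hx g⁻¹
        have := mul_mem (hg x hx) (hh _ hx')
        convert this using 1
        group
      inv_mem' := fun {g} hg x hx => by
        have hx' : g * x * g⁻¹ ∈ T := ‹T.Normal›.conj_mem x hx g
        have := inv_mem (hg _ hx')
        convert this using 1
        group }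
  have hS : S = ⊤ := by
    refine hgen S ?_ ?_
    · rintro _ ⟨y, rfl⟩ _ hxT
      obtain ⟨x, hx, rfl⟩ := hT hxT
      refine ⟨x⁻¹ * (y⁻¹ * x * y), ?_, by simp⟩
      have h : MonoidAlgebra.of ℤ H (x⁻¹ * (y⁻¹ * x * y)) - 1 =
          MonoidAlgebra.of ℤ H x⁻¹ * (MonoidAlgebra.of ℤ H y⁻¹ *
            ((MonoidAlgebra.of ℤ H x - 1) * (MonoidAlgebra.of ℤ H y - 1) -
              (MonoidAlgebra.of ℤ H y - 1) * (MonoidAlgebra.of ℤ H x - 1))) := by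
        have h1 : MonoidAlgebra.of ℤ H x⁻¹ * (MonoidAlgebra.of ℤ H y⁻¹ *
            (MonoidAlgebra.of ℤ H y * MonoidAlgebra.of ℤ H x)) = 1 := by
          rw [← map_mul, ← map_mul, ← map_mul, inv_mul_cancel_left, inv_mul_cancel, map_one]
        have h2 : (MonoidAlgebra.of ℤ H x - 1) * (MonoidAlgebra.of ℤ H y - 1) -
              (MonoidAlgebra.of ℤ H y - 1) * (MonoidAlgebra.of ℤ H x - 1) =
            MonoidAlgebra.of ℤ H x * MonoidAlgebra.of ℤ H y -
              MonoidAlgebra.of ℤ H y * MonoidAlgebra.of ℤ H x := by noncomm_ring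
        rw [h2, _root_.mul_sub, _root_.mul_sub, h1]
        simp only [map_mul, mul_assoc]
      change _ ∈ congruenceSubgroup U' hU'
      rw [mem_congruenceSubgroup, h]
      exact of_mul_mem_of_augIdeal_mul_mem hU' _ (of_mul_mem_of_augIdeal_mul_mem hU' _
        (sub_mem (hright _ (of_sub_one_mem_augIdeal y) _ hx)
          (hleft _ (of_sub_one_mem_augIdeal y) _ hx)))
    · rintro _ hxT
      obtain ⟨x, hx, rfl⟩ := hT hxT
      refine ⟨x⁻¹ * σ x, ?_, by simp [hσ]⟩
      have h : MonoidAlgebra.of ℤ H (x⁻¹ * σ x) - 1 =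
          MonoidAlgebra.of ℤ H x⁻¹ * twist σ (MonoidAlgebra.of ℤ H x - 1) := by
        rw [map_sub, twist_one, twist_of, _root_.sub_zero, _root_.mul_sub, ← map_mul, ← map_mul,
          inv_mul_cancel, map_one]
      change _ ∈ congruenceSubgroup U' hU'
      rw [mem_congruenceSubgroup, h]
      exact of_mul_mem_of_augIdeal_mul_mem hU' _ (htwist _ hx)
  rw [Subgroup.commutator_le]
  intro x hx g _
  have hg : g⁻¹ ∈ S := hS ▸ Subgroup.mem_top _
  have h := hg x⁻¹ (inv_mem hx)
  rw [commutatorElement_def]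
  convert h using 1
  group

end CongruenceSubgroup

/-! ### The abelianization and `I / I ^ 2` -/

section Abelianization

variable {G : Type*} [Group G] {F : Subgroup G} {H : Type*} [Group H] (e : H ≃* F)

/-- The homomorphism `x [F, F] ↦ x - 1` from the abelianization of `F` to `ℤ[H] / I ^ 2`, for a
group `H` identified with `F`. -/
noncomputable def abToAugQuotient :
    Additive (Abelianization F) →+ ℤ[H] ⧸ (augIdeal H ^ 2) :=
  MonoidHom.toAdditiveLeft <| Abelianization.lift
    { toFun := fun x => Multiplicative.ofAdd
        ((augIdeal H ^ 2).mkQ (MonoidAlgebra.of ℤ H (e.symm x) - 1))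
      map_one' := by
        rw [map_one, map_one, ofAdd_eq_one]
        exact (congrArg (augIdeal H ^ 2).mkQ (sub_self (1 : ℤ[H]))).trans (map_zero _)
      map_mul' := fun x y => by
        rw [← ofAdd_add, ← map_add]
        congr 1
        rw [← sub_eq_zero, ← map_sub, Submodule.mkQ_apply, Submodule.Quotient.mk_eq_zero]
        have h : MonoidAlgebra.of ℤ H (e.symm (x * y)) - 1 -
            (MonoidAlgebra.of ℤ H (e.symm x) - 1 + (MonoidAlgebra.of ℤ H (e.symm y) - 1)) =
            (MonoidAlgebra.of ℤ H (e.symm x) - 1) * (MonoidAlgebra.of ℤ H (e.symm y) - 1) := by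
          rw [map_mul, map_mul]; noncomm_ring
        rw [h, pow_two]
        exact Submodule.mul_mem_mul (of_sub_one_mem_augIdeal _) (of_sub_one_mem_augIdeal _) }

theorem abToAugQuotient_of (x : F) :
    abToAugQuotient e (Additive.ofMul (Abelianization.of x)) =
      (augIdeal H ^ 2).mkQ (MonoidAlgebra.of ℤ H (e.symm x) - 1) := rfl

theorem additive_abelianization_induction {P : Additive (Abelianization F) → Prop}
    (h : ∀ x : F, P (Additive.ofMul (Abelianization.of x))) (z : Additive (Abelianization F)) :
    P z :=
  QuotientGroup.induction_on (C := fun z => P (Additive.ofMul z)) (Additive.toMul z) h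

theorem exists_abToAugQuotient_eq {u : ℤ[H]} (hu : u ∈ augIdeal H) :
    ∃ z, abToAugQuotient e z = (augIdeal H ^ 2).mkQ u := by
  rw [augIdeal_eq_span] at hu
  induction hu using Submodule.span_induction with
  | mem u hu =>
    obtain ⟨x, rfl⟩ := hu
    exact ⟨Additive.ofMul (Abelianization.of (e x)), by rw [abToAugQuotient_of, e.symm_apply_apply]⟩
  | zero => exact ⟨0, by rw [map_zero, map_zero]⟩
  | add u v _ _ hu hv =>
    obtain ⟨y, hy⟩ := hu
    obtain ⟨z, hz⟩ := hv
    exact ⟨y + z, by rw [map_add, map_add, hy, hz]⟩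
  | smul r u _ hu =>
    obtain ⟨z, hz⟩ := hu
    exact ⟨r • z, by rw [map_zsmul, map_smul, hz]⟩

variable [F.Normal] {a : G} {σ : H →* H} (hσ : ∀ x, (e (σ x) : G) = a⁻¹ * e x * a)
include hσ

theorem mkQ_twist_eq {z : Additive (Abelianization F)} {u : ℤ[H]}
    (h : (augIdeal H ^ 2).mkQ u = abToAugQuotient e z) :
    (augIdeal H ^ 2).mkQ (twist σ u) = abToAugQuotient e ((conjOnAb F a - 1) z) := by
  induction z using additive_abelianization_induction with
  | h x =>
    obtain ⟨x, rfl⟩ := e.surjective x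
    have hx : (conjOnAb F a) (Additive.ofMul (Abelianization.of (e x))) =
        Additive.ofMul (Abelianization.of (e (σ x))) := by
      rw [conjOnAb_of]
      congr 2
      exact Subtype.ext (hσ x).symm
    rw [LinearMap.sub_apply, Module.End.one_apply, map_sub, hx, abToAugQuotient_of,
      abToAugQuotient_of, e.symm_apply_apply, e.symm_apply_apply, ← map_sub, ← sub_eq_zero,
      ← map_sub, Submodule.mkQ_apply, Submodule.Quotient.mk_eq_zero]
    rw [abToAugQuotient_of, e.symm_apply_apply, ← sub_eq_zero, ← map_sub, Submodule.mkQ_apply,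
      Submodule.Quotient.mk_eq_zero] at h
    convert twist_mem_augIdeal_pow σ h using 1
    rw [map_sub, map_sub, twist_one, twist_of]
    noncomm_ring

theorem mkQ_twist_pow_eq (m : ℕ) {z : Additive (Abelianization F)} {u : ℤ[H]}
    (h : (augIdeal H ^ 2).mkQ u = abToAugQuotient e z) :
    (augIdeal H ^ 2).mkQ ((twist σ ^ m) u) =
      abToAugQuotient e (((conjOnAb F a - 1) ^ m) z) := by
  induction m with
  | zero => exact h
  | succ m ih =>
    rw [pow_succ' (twist σ), pow_succ' (conjOnAb F a - 1), Module.End.mul_apply,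
      Module.End.mul_apply]
    exact mkQ_twist_eq e hσ ih

theorem twist_pow_mem_of_conjOnAb {m M : ℕ}
    (h : ∀ x : Additive (Abelianization F), ∃ y : Additive (Abelianization F),
      ((conjOnAb F a - 1) ^ m) x = M • y) {u : ℤ[H]} (hu : u ∈ augIdeal H) :
    (twist σ ^ m) u ∈ augIdealMod H M 1 := by
  obtain ⟨z, hz⟩ := exists_abToAugQuotient_eq e hu
  have h1 := mkQ_twist_pow_eq e hσ m hz.symm
  obtain ⟨y, hy⟩ := h z
  rw [hy, map_nsmul] at h1
  induction y using additive_abelianization_induction with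
  | h x =>
    rw [abToAugQuotient_of, ← map_nsmul, ← sub_eq_zero, ← map_sub, Submodule.mkQ_apply,
      Submodule.Quotient.mk_eq_zero] at h1
    refine mem_augIdealMod.2 ⟨MonoidAlgebra.of ℤ H (e.symm x) - 1, ?_, _, h1, ?_⟩
    · rw [pow_one]; exact of_sub_one_mem_augIdeal _
    · rw [natCast_zsmul]; exact add_sub_cancel _ _

end Abelianization

/-! ### The filtration between consecutive dimension subgroups -/

section Layers

variable {H : Type*} [Group H]

/-- The dimension subgroup `{x | x - 1 ∈ I ^ (k + 1)}` of `H`, where `I` is the augmentation ideal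
of `ℤ[H]`. -/
noncomputable def dimensionSubgroup (H : Type*) [Group H] (k : ℕ) : Subgroup H :=
  congruenceSubgroup (augIdeal H ^ (k + 1)) fun u _ _ hv =>
    mul_mem_augIdeal_pow_left (by omega) u hv

theorem mem_dimensionSubgroup {k : ℕ} {x : H} :
    x ∈ dimensionSubgroup H k ↔ MonoidAlgebra.of ℤ H x - 1 ∈ augIdeal H ^ (k + 1) := Iff.rfl

theorem dimensionSubgroup_zero : dimensionSubgroup H 0 = ⊤ := by
  refine eq_top_iff.2 fun x _ => ?_
  rw [mem_dimensionSubgroup, zero_add, pow_one]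
  exact of_sub_one_mem_augIdeal x

variable (σ : H →* H)

/-- The submodule `(σ - 1) ^ j I ^ (k + 1) + I ^ (k + 2)`, between consecutive powers of the
augmentation ideal `I`. -/
noncomputable def layer (k j : ℕ) : Submodule ℤ ℤ[H] :=
  (augIdeal H ^ (k + 1)).map (twist σ ^ j) ⊔ augIdeal H ^ (k + 2)

theorem layer_le (k j : ℕ) : layer σ k j ≤ augIdeal H ^ (k + 1) := by
  refine sup_le ?_ (augIdeal_pow_succ_le (by omega))
  rintro _ ⟨v, hv, rfl⟩
  exact twist_pow_mem_augIdeal_pow σ j hv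

theorem augIdeal_pow_le_layer_zero (k : ℕ) : augIdeal H ^ (k + 1) ≤ layer σ k 0 :=
  fun u hu => Submodule.mem_sup_left ⟨u, hu, rfl⟩

theorem twist_mem_layer {k j : ℕ} {u : ℤ[H]} (hu : u ∈ layer σ k j) :
    twist σ u ∈ layer σ k (j + 1) := by
  obtain ⟨_, ⟨v, hv, rfl⟩, w, hw, rfl⟩ := Submodule.mem_sup.1 hu
  rw [map_add, ← Module.End.mul_apply, ← pow_succ']
  exact add_mem (Submodule.mem_sup_left ⟨v, hv, rfl⟩)
    (Submodule.mem_sup_right (twist_mem_augIdeal_pow σ hw))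

theorem mul_mem_layer_left {k j : ℕ} (i : ℕ) {u v : ℤ[H]} (hu : u ∈ augIdeal H)
    (hv : v ∈ layer σ k j) : u * v ∈ layer σ k i := by
  refine Submodule.mem_sup_right ?_
  rw [pow_succ']
  exact Submodule.mul_mem_mul hu (layer_le σ k j hv)

theorem mul_mem_layer_right {k j : ℕ} (i : ℕ) {u v : ℤ[H]} (hu : u ∈ augIdeal H)
    (hv : v ∈ layer σ k j) : v * u ∈ layer σ k i := by
  refine Submodule.mem_sup_right ?_
  rw [pow_succ]
  exact Submodule.mul_mem_mul (layer_le σ k j hv) hu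

/-- The congruence subgroup of `layer σ k j`. For fixed `k` these subgroups descend from one
dimension subgroup towards the next. -/
noncomputable def layerSubgroup (k j : ℕ) : Subgroup H :=
  congruenceSubgroup (layer σ k j) fun _ hu _ hv => mul_mem_layer_left σ j hu hv

theorem mem_layerSubgroup {k j : ℕ} {x : H} :
    x ∈ layerSubgroup σ k j ↔ MonoidAlgebra.of ℤ H x - 1 ∈ layer σ k j := Iff.rfl

end Layers

/-! ### Descent of the transfinite lower central series -/

section LowerCentralSeries

variable {G : Type u} [Group G] {H : Type*} [Group H] {θ : H →* G} {σ : H →* H} {a : G}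
  (hσ : ∀ x, θ (σ x) = a⁻¹ * θ x * a)
  (hgen : ∀ S : Subgroup G, θ.range ≤ S → a ∈ S → S = ⊤)
include hσ hgen

theorem transLCS_add_nat_le {β : Ordinal.{u}} (hβ : 1 ≤ β) {k : ℕ}
    (h : transLCS G β ≤ (dimensionSubgroup H k).map θ) (j : ℕ) :
    transLCS G (β + j) ≤ (layerSubgroup σ k j).map θ := by
  induction j with
  | zero =>
    rw [Nat.cast_zero, add_zero]
    exact h.trans (Subgroup.map_mono fun x hx => augIdeal_pow_le_layer_zero σ k hx)
  | succ j ih =>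
    rw [Nat.cast_succ, ← add_assoc, transLCS_add_one G (hβ.trans le_self_add)]
    have := transLCS_normal G (β + j)
    exact commutator_le_map_congruenceSubgroup θ σ a hσ hgen _ _ _ ih
      (fun u hu => twist_mem_layer σ hu) (fun u hu v hv => mul_mem_layer_left σ _ hu hv)
      (fun u hu v hv => mul_mem_layer_right σ _ hu hv)

/-- If `σ - 1` is nilpotent on `I / I ^ 2` (the case `M = 0`), the finite terms of the lower central
series descend below every dimension subgroup. -/
theorem exists_transLCS_nat_le {m : ℕ} (hm : ∀ u ∈ augIdeal H, (twist σ ^ m) u ∈ augIdealMod H 0 1)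
    (h2 : transLCS G 2 ≤ θ.range) (k : ℕ) :
    ∃ b : ℕ, transLCS G ((b + 1 : ℕ) : Ordinal) ≤ (dimensionSubgroup H k).map θ := by
  induction k with
  | zero =>
    refine ⟨1, ?_⟩
    rw [dimensionSubgroup_zero, ← MonoidHom.range_eq_map]
    exact_mod_cast h2
  | succ k ih =>
    obtain ⟨b, hb⟩ := ih
    obtain ⟨N, hN⟩ := exists_twist_pow_mem σ hm (k := k + 1) (by omega)
    refine ⟨b + N, ?_⟩
    have h := transLCS_add_nat_le hσ hgen (by exact_mod_cast Nat.le_add_left 1 b) hb N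
    rw [← Nat.cast_add, add_right_comm] at h
    refine h.trans (Subgroup.map_mono fun x hx => ?_)
    rw [mem_layerSubgroup] at hx
    rw [mem_dimensionSubgroup]
    -- `(σ - 1) ^ N` sends `I ^ (k + 1)` into `I ^ (k + 2)`, so layer `N` lies in `I ^ (k + 2)`.
    refine (sup_le ?_ le_rfl : layer σ k N ≤ _) hx
    rintro _ ⟨v, hv, rfl⟩
    obtain ⟨v', _, w, hw, hvw⟩ := mem_augIdealMod.1 (hN v hv)
    rw [Nat.cast_zero, zero_smul, zero_add] at hvw
    exact hvw ▸ hw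

/-- If `σ - 1` is nilpotent on `I / I ^ 2` modulo `M`, and `I ^ (k + 1) / I ^ (k + 2)` is
`M`-adically separated, then `ω` steps of the lower central series lead from one dimension subgroup
to the next. -/
theorem transLCS_add_omega_le (hθ : Function.Injective θ) {m M : ℕ}
    (hm : ∀ u ∈ augIdeal H, (twist σ ^ m) u ∈ augIdealMod H M 1) {k : ℕ}
    (hsep : ∀ u : ℤ[H], (∀ j, u ∈ augIdealMod H (M ^ j) (k + 1)) → u ∈ augIdeal H ^ (k + 2))
    {β : Ordinal.{u}} (hβ : 1 ≤ β) (h : transLCS G β ≤ (dimensionSubgroup H k).map θ) :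
    transLCS G (β + ω) ≤ (dimensionSubgroup H (k + 1)).map θ := by
  obtain ⟨N, hN⟩ := exists_twist_pow_mem σ hm (k := k + 1) (by omega)
  have hlayer (j : ℕ) : transLCS G (β + ω) ≤ (layerSubgroup σ k j).map θ :=
    (transLCS_antitone G (by gcongr; exact (natCast_lt_omega0 j).le)).trans
      (transLCS_add_nat_le hσ hgen hβ h j)
  intro g hg
  obtain ⟨x, _, rfl⟩ := hlayer 0 hg
  refine ⟨x, hsep _ fun j => ?_, rfl⟩
  obtain ⟨y, hy, hyx⟩ := hlayer (N * j) hg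
  obtain rfl := hθ hyx
  refine (sup_le ?_ le_sup_right : layer σ k (N * j) ≤ _) hy
  rintro _ ⟨v, hv, rfl⟩
  exact twist_pow_mul_mem_augIdealMod σ hN j hv

theorem transLCS_omega_mul_le (hθ : Function.Injective θ) {m M : ℕ}
    (hm : ∀ u ∈ augIdeal H, (twist σ ^ m) u ∈ augIdealMod H M 1)
    (hsep : ∀ (k : ℕ) (u : ℤ[H]),
      (∀ j, u ∈ augIdealMod H (M ^ j) (k + 1)) → u ∈ augIdeal H ^ (k + 2))
    (h2 : transLCS G 2 ≤ θ.range) (k : ℕ) :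
    transLCS G (2 + ω * k) ≤ (dimensionSubgroup H k).map θ := by
  induction k with
  | zero =>
    rw [dimensionSubgroup_zero, ← MonoidHom.range_eq_map, Nat.cast_zero, mul_zero, add_zero]
    exact h2
  | succ k ih =>
    rw [Nat.cast_succ, mul_add_one, ← add_assoc]
    exact transLCS_add_omega_le hσ hgen hθ hm (hsep k)
      (le_trans (by exact_mod_cast one_le_two) le_self_add) ih

end LowerCentralSeries

/-! ### Residual nilpotence, length, and cyclic extensions -/

section Conclusions

variable {G : Type u} [Group G]

theorem transLCS_natCast_add_one (n : ℕ) :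
    transLCS G ((n + 1 : ℕ) : Ordinal) = (⊤ : Subgroup G).lowerCentralSeries n := by
  induction n with
  | zero => rw [zero_add, Nat.cast_one, transLCS_one, Subgroup.lowerCentralSeries_zero]
  | succ n ih =>
    rw [Nat.cast_succ, transLCS_add_one G (by exact_mod_cast Nat.le_add_left 1 n), ih,
      Subgroup.lowerCentralSeries_succ]

theorem isResiduallyNilpotent_of_transLCS
    (h : ∀ g : G, g ≠ 1 → ∃ b : ℕ, g ∉ transLCS G ((b + 1 : ℕ) : Ordinal)) :
    IsResiduallyNilpotent G := by
  intro g hg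
  obtain ⟨b, hb⟩ := h g hg
  have := transLCS_normal G ((b + 1 : ℕ) : Ordinal)
  refine ⟨G ⧸ transLCS G ((b + 1 : ℕ) : Ordinal), inferInstance, ?_, QuotientGroup.mk' _, ?_⟩
  · refine Subgroup.nilpotent_iff_lowerCentralSeries.2 ⟨b, ?_⟩
    rw [← MonoidHom.range_eq_top.2 (QuotientGroup.mk'_surjective _), MonoidHom.range_eq_map,
      ← Subgroup.map_lowerCentralSeries, ← transLCS_natCast_add_one, QuotientGroup.map_mk'_self]
  · rwa [QuotientGroup.mk'_apply, Ne, QuotientGroup.eq_one_iff]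

theorem lcsLength_le_of_transLCS_eq_bot {α : Ordinal.{u}} (h : transLCS G α = ⊥) :
    lcsLength G ≤ α := by
  refine csSup_le' fun β hβ => ?_
  by_contra! hlt
  have hbot {γ : Ordinal.{u}} (hγ : α ≤ γ) : transLCS G γ = ⊥ :=
    le_bot_iff.1 (h ▸ transLCS_antitone G hγ)
  exact hβ.2 ((hbot hlt.le).trans (hbot (hlt.le.trans le_self_add)).symm)

theorem eq_top_of_zpowers_quotient_eq_top {F : Subgroup G} [F.Normal] {a : G}
    (hgen : Subgroup.zpowers (a : G ⧸ F) = ⊤) {S : Subgroup G} (hF : F ≤ S) (ha : a ∈ S) :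
    S = ⊤ := by
  refine eq_top_iff.2 fun g _ => ?_
  obtain ⟨i, hi⟩ : (g : G ⧸ F) ∈ Subgroup.zpowers (a : G ⧸ F) := hgen ▸ Subgroup.mem_top _
  have h : (a ^ i)⁻¹ * g ∈ F := QuotientGroup.eq.1 hi
  simpa using mul_mem (zpow_mem ha i) (hF h)

theorem transLCS_two_le {F : Subgroup G} [F.Normal] {a : G}
    (hgen : Subgroup.zpowers (a : G ⧸ F) = ⊤) : transLCS G 2 ≤ F := by
  rw [← one_add_one_eq_two, transLCS_add_one G le_rfl, transLCS_one, Subgroup.commutator_le]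
  intro g _ h _
  obtain ⟨i, hi⟩ : (g : G ⧸ F) ∈ Subgroup.zpowers (a : G ⧸ F) := hgen ▸ Subgroup.mem_top _
  obtain ⟨j, hj⟩ : (h : G ⧸ F) ∈ Subgroup.zpowers (a : G ⧸ F) := hgen ▸ Subgroup.mem_top _
  rw [← QuotientGroup.eq_one_iff, ← QuotientGroup.mk'_apply, map_commutatorElement,
    commutatorElement_eq_one_iff_mul_comm, QuotientGroup.mk'_apply, QuotientGroup.mk'_apply,
    ← hi, ← hj]
  exact zpow_mul_comm _ _ _

end Conclusions

/-! ### Finite rank free-by-cyclic groups -/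

theorem mainTheorem1 {G : Type u} [Group G] (F : Subgroup G) [F.Normal] (n : ℕ) (hn : 2 ≤ n)
    (hfree : Nonempty (FreeGroup (Fin n) ≃* F))
    (a : G) (hinf : Infinite (G ⧸ F)) (hgen : Subgroup.zpowers (a : G ⧸ F) = ⊤) :
    ((conjOnAb F a - 1) ^ n = 0 →
      IsResiduallyNilpotent G ∧ transLCS G ω = ⊥) ∧
    (∀ m M : ℕ, 2 ≤ M →
      (∀ x : Additive (Abelianization F), ∃ y : Additive (Abelianization F),
        ((conjOnAb F a - 1) ^ m) x = M • y) →
      lcsLength G ≤ ω ^ 2 ∧ transLCS G (ω ^ 2) = ⊥) := by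
  obtain ⟨e⟩ := hfree
  have : Nontrivial (Fin n) := Fin.nontrivial_iff_two_le.2 hn
  let θ : FreeGroup (Fin n) →* G := F.subtype.comp e.toMonoidHom
  have hθ : Function.Injective θ := F.subtype_injective.comp e.injective
  have hrange : θ.range = F := by
    rw [MonoidHom.range_comp, MonoidHom.range_eq_top.2 e.surjective, ← MonoidHom.range_eq_map,
      F.range_subtype]
  let σ : FreeGroup (Fin n) →* FreeGroup (Fin n) :=
    e.symm.toMonoidHom.comp ((MulAut.conjNormal (H := F) a⁻¹).toMonoidHom.comp e.toMonoidHom)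
  have hσ (x) : (e (σ x) : G) = a⁻¹ * e x * a := by simp [σ]
  have hgen' (S : Subgroup G) (hS : θ.range ≤ S) (ha : a ∈ S) : S = ⊤ :=
    eq_top_of_zpowers_quotient_eq_top hgen (hrange ▸ hS) ha
  have h2 : transLCS G 2 ≤ θ.range := hrange.symm ▸ transLCS_two_le hgen
  have hbot {g : G} (hg : ∀ k, g ∈ (dimensionSubgroup (FreeGroup (Fin n)) k).map θ) : g = 1 := by
    obtain ⟨x, _, rfl⟩ := hg 0
    suffices hx : x = 1 by rw [hx, map_one]
    refine eq_one_of_forall_sub_one_mem_augIdeal_pow x fun k hk => ?_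
    obtain ⟨k, rfl⟩ := Nat.exists_eq_add_of_le' hk
    obtain ⟨y, hy, hyx⟩ := hg k
    exact hθ hyx ▸ hy
  refine ⟨fun hα => ?_, fun m M hM hα => ?_⟩
  · have hm : ∀ u ∈ augIdeal (FreeGroup (Fin n)), (twist σ ^ n) u ∈ augIdealMod _ 0 1 :=
      fun u hu => twist_pow_mem_of_conjOnAb e hσ (fun x => ⟨0, by rw [hα]; simp⟩) hu
    have hb := exists_transLCS_nat_le (θ := θ) hσ hgen' hm h2
    have hres (g : G) (hg : g ≠ 1) : ∃ b : ℕ, g ∉ transLCS G ((b + 1 : ℕ) : Ordinal) := by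
      by_contra! h
      exact hg (hbot fun k => (hb k).elim fun b hb => hb (h b))
    refine ⟨isResiduallyNilpotent_of_transLCS hres, (Subgroup.eq_bot_iff_forall _).2 fun g hg => ?_⟩
    by_contra h
    obtain ⟨b, hb⟩ := hres g h
    exact hb (transLCS_antitone G (natCast_lt_omega0 _).le hg)
  · have hm : ∀ u ∈ augIdeal (FreeGroup (Fin n)), (twist σ ^ m) u ∈ augIdealMod _ M 1 :=
      fun u hu => twist_pow_mem_of_conjOnAb e hσ hα hu
    have hsep (k : ℕ) (u : ℤ[FreeGroup (Fin n)])
        (hu : ∀ j, u ∈ augIdealMod (FreeGroup (Fin n)) (M ^ j) (k + 1)) :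
        u ∈ augIdeal (FreeGroup (Fin n)) ^ (k + 2) := by
      refine mem_augIdeal_pow_of_forall_pow_smul hM (k + 1) u fun j => ?_
      obtain ⟨v, hv, w, hw, rfl⟩ := mem_augIdealMod.1 (hu j)
      refine ⟨v, fun _ => hv, ?_⟩
      rwa [natCast_zsmul, add_sub_cancel_left]
    have hω : transLCS G (ω ^ 2) = ⊥ := by
      refine (Subgroup.eq_bot_iff_forall _).2 fun g hg => hbot fun k => ?_
      refine transLCS_omega_mul_le (θ := θ) hσ hgen' hθ hm hsep h2 k (transLCS_antitone G ?_ hg)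
      calc (2 : Ordinal) + ω * k ≤ ω + ω * k := by
            gcongr
            exact_mod_cast (natCast_lt_omega0 2).le
        _ = ω * ((1 + k : ℕ) : Ordinal) := by rw [Nat.cast_add, Nat.cast_one, mul_one_add]
        _ ≤ ω * ω := by
            gcongr
            exact (natCast_lt_omega0 _).le
        _ = ω ^ 2 := (pow_two ω).symm
    exact ⟨lcsLength_le_of_transLCS_eq_bot hω, hω⟩
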